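/- Let $G$ be a locally compact, Hausdorff, second countable group with left Haar measure $m$. Let $M(G)$ be the space of complex Borel measures on $G$ with the total variation norm, and for $\mu\in M(G)$ let $\lambda(\mu)$ be the bounded operator on $L^2(G)$ given by $\lambda(\mu)\xi=\int_G\lambda_s\xi\,d\mu(s)$, where $(\lambda_s\xi)(g)=\xi(s^{-1}g)$. Let $C_r^*(G)$ be the operator norm closure of $\{\lambda(f\,dm): f\in L^1(G)\}$. Let $\mathcal F(G)$ be the set of closed subsets of $G$ with the Fell topology, which is compact and metrizable and generated by the sets $\{F: F\cap K=\emptyset\}$ with $K\subseteq G$ compact and $\{F: F\cap U\neq\emptyset\}$ with $U\subseteq G$ open (its Borel sets form the Effros Borel structure). For a closed set $E\subseteq G$ let $M(E)$ be the set of $\mu\in M(G)$ with $\operatorname{supp}\mu\subseteq E$. Put $$\mathcal U_0(G)=\{E\in\mathcal F(G):\lambda(M(E))\cap C_r^*(G)=\{0\}\},\qquad \mathcal M_0(G)=\mathcal F(G)\setminus\mathcal U_0(G).$$ Then $\mathcal U_0(G)$ is coanalytic in $\mathcal F(G)$. Moreover, let $B_1(M(G))=\{\mu\in M(G):\|\mu\|\le1\}$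 carry the weak-$*$ topology of $M(G)=C_0(G)^*$. Then the set $$P=\{(\mu,E)\in B_1(M(G))\times\mathcal F(G):\ \mu\in M(E),\ \lambda(\mu)\in C_r^*(G),\ \lambda(\mu)\neq0\}$$ is analytic in $B_1(M(G))\times\mathcal F(G)$, and $\mathcal M_0(G)$ is its projection to $\mathcal F(G)$. -/

import Mathlib

open MeasureTheory TopologicalSpace Set
open scoped ENNReal ZeroAtInfty

noncomputable section

namespace Uniqueness

/-- A complex measure has finite total variation. -/
instance isFiniteMeasure_variation {X : Type*} [MeasurableSpace X] (μ : ComplexMeasure X) :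
    IsFiniteMeasure μ.variation := by
  have h : μ.variation ≤ (ComplexMeasure.re μ).totalVariation
      + (ComplexMeasure.im μ).totalVariation := by
    refine VectorMeasure.variation_le_of_forall_enorm_le fun s hs ↦ ?_
    rw [Measure.add_apply]
    refine le_trans ?_ (add_le_add
      (SignedMeasure.enorm_le_totalVariation (ComplexMeasure.re μ) s)
      (SignedMeasure.enorm_le_totalVariation (ComplexMeasure.im μ) s))
    change ‖μ s‖ₑ ≤ ‖(μ s).re‖ₑ + ‖(μ s).im‖ₑ
    simp only [enorm_eq_nnnorm]
    norm_cast
    rw [← NNReal.coe_le_coe]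
    simpa using Complex.norm_le_abs_re_add_abs_im (μ s)
  exact isFiniteMeasure_of_le _ h

/-! ### Integration against a complex measure -/

section Integral

variable {X V : Type*} [MeasurableSpace X] [NormedAddCommGroup V] [NormedSpace ℂ V]

/-- The pairing `(v, z) ↦ z • v`. -/
def smulPairing (V : Type*) [NormedAddCommGroup V] [NormedSpace ℂ V] : V →L[ℝ] ℂ →L[ℝ] V :=
  (ContinuousLinearMap.lsmul ℝ ℂ).flip

/-- The Bochner integral `∫ f dμ` of a vector-valued function against a complex measure. -/
def cintegral (μ : ComplexMeasure X) (f : X → V) : V :=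
  μ.integral f (smulPairing V)

theorem cintegral_add {μ : ComplexMeasure X} {f g : X → V} (hf : μ.Integrable f)
    (hg : μ.Integrable g) :
    cintegral μ (fun x ↦ f x + g x) = cintegral μ f + cintegral μ g :=
  VectorMeasure.integral_fun_add hf hg

theorem cintegral_smul [CompleteSpace V] {μ : ComplexMeasure X} {f : X → V}
    (hf : μ.Integrable f) (c : ℂ) :
    cintegral μ (fun x ↦ c • f x) = c • cintegral μ f := by
  let C : V →L[ℝ] V := ContinuousLinearMap.lsmul ℝ ℂ c
  have h1 := VectorMeasure.integral_continuousLinearMap_comp (B := smulPairing V) (C := C) hf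
  have h2 := VectorMeasure.continuousLinearMap_apply_integral (B := smulPairing V) (C := C) hf
  have h3 : smulPairing V ∘L C = (ContinuousLinearMap.compL ℝ ℂ V V C) ∘L smulPairing V := by
    refine ContinuousLinearMap.ext fun v ↦ ContinuousLinearMap.ext fun z ↦ ?_
    change z • c • v = c • z • v
    exact smul_comm z c v
  rw [h3, ← h2] at h1
  exact h1

theorem norm_cintegral_le {μ : ComplexMeasure X} {f : X → V} {M : ℝ} (hM : 0 ≤ M)
    (hf : ∀ x, ‖f x‖ ≤ M) : ‖cintegral μ f‖ ≤ μ.variation.real univ * M := by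
  have h1 : ‖smulPairing V‖ ≤ 1 :=
    ContinuousLinearMap.opNorm_le_bound _ zero_le_one fun v ↦
      ContinuousLinearMap.opNorm_le_bound _ (by positivity) fun z ↦ by
        change ‖z • v‖ ≤ 1 * ‖v‖ * ‖z‖
        rw [norm_smul, one_mul, mul_comm]
  have h2 : ‖cintegral μ f‖ ≤ M * ‖smulPairing V‖ * μ.variation.real univ :=
    VectorMeasure.norm_integral_le_of_norm_le_const (Filter.Eventually.of_forall hf)
  refine h2.trans ?_
  rw [mul_comm]
  gcongr
  exact mul_le_of_le_one_right hM h1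

end Integral

/-! ### The hyperspace of closed sets -/

/-- The set `F(X)` of closed subsets of `X`; it carries the Fell topology. -/
def ClosedSets (X : Type*) [TopologicalSpace X] : Type _ := Closeds X

/-- The Fell topology, generated by the sets `{F | F ∩ K = ∅}` for `K` compact and
`{F | F ∩ U ≠ ∅}` for `U` open. -/
instance fellTopology (X : Type*) [TopologicalSpace X] : TopologicalSpace (ClosedSets X) :=
  generateFrom
    ({A | ∃ K : Set X, IsCompact K ∧ A = {F : Closeds X | (F : Set X) ∩ K = ∅}} ∪
     {A | ∃ U : Set X, IsOpen U ∧ A = {F : Closeds X | ((F : Set X) ∩ U).Nonempty}})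

/-- The underlying set of an element of `F(X)`. -/
def ClosedSets.carrier {X : Type*} [TopologicalSpace X] (E : ClosedSets X) : Set X :=
  Closeds.carrier E

/-- A set is coanalytic if its complement is analytic (a continuous image of a Polish space). -/
def IsCoanalytic {X : Type*} [TopologicalSpace X] (A : Set X) : Prop := AnalyticSet Aᶜ

/-! ### The unit ball of `M(X)` with the weak-star topology -/

/-- The measures in `M(X)` of total variation norm at most `1`. -/
def MeasureBall (X : Type*) [MeasurableSpace X] : Type _ :=
  {μ : ComplexMeasure X // μ.variation univ ≤ 1}

/-- The topology on the unit ball of `M(X)` given by `M(X) = C₀(X)*`: the coarsest one that makes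
`μ ↦ ∫ f dμ` continuous for every `f ∈ C₀(X)`. -/
instance weakStarTopology (X : Type*) [TopologicalSpace X] [MeasurableSpace X] :
    TopologicalSpace (MeasureBall X) :=
  TopologicalSpace.induced
    (fun μ (f : C₀(X, ℂ)) ↦ cintegral μ.1 f) inferInstance

/-- `M(E)`: the complex measures whose (closed) support is contained in `E`. -/
def measuresOn {X : Type*} [TopologicalSpace X] [MeasurableSpace X] (E : Set X) :
    Set (ComplexMeasure X) :=
  {μ | μ.variation.support ⊆ E}

/-! ### The regular representation -/

section Regular

variable {G : Type*} [Group G] [TopologicalSpace G] [IsTopologicalGroup G] [T2Space G]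
  [LocallyCompactSpace G] [SecondCountableTopology G] [MeasurableSpace G] [BorelSpace G]

/-- The left regular representation of a group `G` with left Haar measure `m` on `L²(G, m)`:
`(leftReg m s ξ)(g) = ξ(s⁻¹ g)`. -/
def leftReg (m : Measure G) [m.IsHaarMeasure] (s : G) : Lp ℂ 2 m →ₗᵢ[ℂ] Lp ℂ 2 m :=
  Lp.compMeasurePreservingₗᵢ ℂ (fun g ↦ s⁻¹ * g) (measurePreserving_mul_left m s⁻¹)

theorem continuous_leftReg (m : Measure G) [m.IsHaarMeasure] (ξ : Lp ℂ 2 m) :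
    Continuous fun s : G ↦ leftReg m s ξ := by
  let : UniformSpace G := IsTopologicalGroup.rightUniformSpace G
  have : m.InnerRegularCompactLTTop := inferInstance
  have : Fact ((2 : ℝ≥0∞) ≠ ∞) := ⟨by simp⟩
  have h1 : Continuous fun s : G ↦ (DomMulAct.mk s⁻¹ : DomMulAct G) :=
    DomMulAct.continuous_mk.comp continuous_inv
  exact h1.smul (continuous_const (y := ξ))

theorem integrable_leftReg (m : Measure G) [m.IsHaarMeasure] (μ : ComplexMeasure G)
    (ξ : Lp ℂ 2 m) : μ.Integrable fun s ↦ leftReg m s ξ :=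
  Integrable.of_bound (continuous_leftReg m ξ).aestronglyMeasurable ‖ξ‖
    (Filter.Eventually.of_forall fun s ↦ by simp)

/-- The operator `λ(μ) ξ = ∫ λ_s ξ dμ(s)` on `L²(G)`, for a complex measure `μ`. -/
def convOp (m : Measure G) [m.IsHaarMeasure] (μ : ComplexMeasure G) :
    Lp ℂ 2 m →L[ℂ] Lp ℂ 2 m :=
  LinearMap.mkContinuous
    { toFun := fun ξ ↦ cintegral μ fun s ↦ leftReg m s ξ
      map_add' := fun ξ η ↦ by
        simp only [map_add]
        exact cintegral_add (integrable_leftReg m μ ξ) (integrable_leftReg m μ η)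
      map_smul' := fun c ξ ↦ by
        simp only [map_smul]
        exact cintegral_smul (integrable_leftReg m μ ξ) c }
    (μ.variation.real univ)
    (fun ξ ↦ norm_cintegral_le (norm_nonneg ξ) fun s ↦ by simp)

/-- The reduced group C*-algebra: the operator norm closure of `{λ(f) | f ∈ L¹(G)}`, where `f` is
identified with the measure `f dm`. -/
def reducedCstar (m : Measure G) [m.IsHaarMeasure] : Set (Lp ℂ 2 m →L[ℂ] Lp ℂ 2 m) :=
  closure (range fun f : Lp ℂ 1 m ↦ convOp m (m.withDensityᵥ f))

/-- `U₀(G)`: the closed sets of extended uniqueness. -/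
def extendedUniqueness (m : Measure G) [m.IsHaarMeasure] : Set (ClosedSets G) :=
  {E | convOp m '' measuresOn E.carrier ∩ reducedCstar m = {0}}

/-- `M₀(G)`: the closed sets of restricted multiplicity. -/
def restrictedMultiplicity (m : Measure G) [m.IsHaarMeasure] : Set (ClosedSets G) :=
  (extendedUniqueness m)ᶜ

/-- The pairs `(μ, E)` with `μ` in the unit ball of `M(G)`, supported in `E`, and with `λ(μ)` a
nonzero element of the reduced C*-algebra. -/
def multiplicityPairs (m : Measure G) [m.IsHaarMeasure] : Set (MeasureBall G × ClosedSets G) :=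
  {p | p.1.1 ∈ measuresOn p.2.carrier ∧ convOp m p.1.1 ∈ reducedCstar m ∧ convOp m p.1.1 ≠ 0}

end Regular

end Uniqueness

end

/-!
The set `P` of multiplicity pairs is shown to be a continuous image of a Borel subset of a compact
metrizable space `Z`. That `B₁(M(G))` and `F(G)` are themselves Polish is not needed.

The space `Z` is the product of two factors. The second consists of the compact subsets `K` of the
one-point compactification `G ∪ {∞}`, with the Vietoris topology; the map `K ↦ K ∩ G` is continuous
and onto `F(G)` (`continuous_traceClosed`, `traceClosed_surjective`). The first consists of the
probability measures `ρ` on `(G ∪ {∞}) × D`, with `D` the closed unit disc. Such a `ρ` gives the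
complex measure `μ_ρ(A) = ∫ 1_A(x) z dρ(x, z)` on `G`, whose total variation is at most `1`. The map
`ρ ↦ μ_ρ` is weak-star continuous, since `z f(x)` is continuous on `(G ∪ {∞}) × D` for
`f ∈ C₀(G)` (`continuous_phaseBall`). It is onto `B₁(M(G))`: in the polar decomposition `dμ = h d|μ|`
push `|μ|` forward along `x ↦ (x, h(x))` and put the missing mass at `(∞, 0)`
(`exists_phaseBall_eq`). For this `ρ` the support condition `supp μ ⊆ E` says that `ρ` has no mass
over `G \ E`, and for every `ρ` this is sufficient for `supp μ_ρ ⊆ E`. Testing it on a countable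
basis shows that it is a Borel condition (`measurableSet_concentrated`).

The coefficients `s ↦ ⟨η, λ_s ξ⟩` lie in `C₀(G)` (`tendsto_inner_leftReg`), so
`μ ↦ ⟨η, λ(μ) ξ⟩` is weak-star continuous and `{μ | ‖λ(μ) - A‖ ≤ r}` is weak-star closed
(`isClosed_setOf_norm_convOp_sub_le`). As `C_r^*(G)` is separable, `λ(μ) ∈ C_r^*(G)` is a Borel
condition on `μ`, and so is `λ(μ) ≠ 0`. Thus `P` is analytic. Its projection is `M₀(G)` because a
measure can be scaled into the unit ball, so `M₀(G)` is analytic as well.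
-/

noncomputable section

namespace Uniqueness

open Filter Topology
open scoped Pointwise

/-! ### Complex measures with a density -/

section Density

variable {X Y : Type*} [MeasurableSpace X] [MeasurableSpace Y]

theorem cintegral_indicator_const (μ : ComplexMeasure X) (c : ℂ) {s : Set X}
    (hs : MeasurableSet s) : cintegral μ (s.indicator fun _ ↦ c) = μ s * c := by
  have h := VectorMeasure.integral_indicator_const (μ := μ) (B := smulPairing ℂ) c hs
  exact h

theorem cintegral_withDensityᵥ_simpleFunc {ν : Measure X} {w : X → ℂ} (hw : Integrable w ν)
    (f : SimpleFunc X ℂ) :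
    cintegral (ν.withDensityᵥ w) f = ∫ x, w x * f x ∂ν := by
  have hint (g : SimpleFunc X ℂ) : Integrable (fun x ↦ w x * g x) ν := by
    obtain ⟨C, hC⟩ := g.exists_forall_norm_le
    exact hw.mul_bdd g.aestronglyMeasurable (Eventually.of_forall hC)
  induction f using SimpleFunc.induction with
  | const c hs =>
    rename_i s
    have h : ⇑(SimpleFunc.piecewise s hs (SimpleFunc.const X c) (SimpleFunc.const X 0)) =
        s.indicator fun _ ↦ c := by
      ext x; simp [SimpleFunc.coe_piecewise, Set.piecewise, Set.indicator]
    rw [h, cintegral_indicator_const _ _ hs, withDensityᵥ_apply hw hs]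
    have h2 : (fun x ↦ w x * s.indicator (fun _ ↦ c) x) = s.indicator fun x ↦ w x * c := by
      ext x; by_cases hx : x ∈ s <;> simp [hx]
    rw [h2, integral_indicator hs, integral_mul_const]
  | add _ hf hg =>
    rename_i f g _
    have h1 := cintegral_add (μ := ν.withDensityᵥ w) (f := f) (g := g)
      f.integrable_of_isFiniteMeasure g.integrable_of_isFiniteMeasure
    have h2 : ⇑(f + g) = fun x ↦ f x + g x := rfl
    rw [h2, h1, hf, hg, ← integral_add (hint f) (hint g)]
    simp only [mul_add]

/-- Integration against the complex measure `w dν`; the integrand is approximated boundedly by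
simple functions. -/
theorem cintegral_withDensityᵥ {ν : Measure X} {w : X → ℂ} (hw : Integrable w ν)
    {f : X → ℂ} (hf : StronglyMeasurable f) {C : ℝ} (hC : ∀ x, ‖f x‖ ≤ C) :
    cintegral (ν.withDensityᵥ w) f = ∫ x, w x * f x ∂ν := by
  rcases isEmpty_or_nonempty X with hX | ⟨⟨x₀⟩⟩
  · have : w = 0 := Subsingleton.elim _ _
    have h := norm_cintegral_le (μ := ν.withDensityᵥ w) (M := 0) le_rfl (fun x : X ↦ hX.elim x)
      (f := f)
    rw [mul_zero, norm_le_zero_iff] at h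
    rw [h, this]
    simp
  have hC0 : 0 ≤ C := (norm_nonneg _).trans (hC x₀)
  have hlim (x : X) : Tendsto (fun n ↦ hf.approxBounded C n x) atTop (𝓝 (f x)) :=
    hf.tendsto_approxBounded_of_norm_le (hC x)
  have h1 : Tendsto (fun n ↦ cintegral (ν.withDensityᵥ w) (hf.approxBounded C n)) atTop
      (𝓝 (cintegral (ν.withDensityᵥ w) f)) :=
    VectorMeasure.tendsto_integral_filter_of_norm_le_const
      (Eventually.of_forall fun n ↦ (hf.approxBounded C n).aestronglyMeasurable)
      ⟨C, Eventually.of_forall fun n ↦ Eventually.of_forall fun x ↦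
        hf.norm_approxBounded_le hC0 n x⟩
      (Eventually.of_forall hlim)
  have h2 : Tendsto (fun n ↦ ∫ x, w x * hf.approxBounded C n x ∂ν) atTop
      (𝓝 (∫ x, w x * f x ∂ν)) := by
    refine tendsto_integral_of_dominated_convergence (fun x ↦ ‖w x‖ * C)
      (fun n ↦ hw.aestronglyMeasurable.mul (hf.approxBounded C n).aestronglyMeasurable)
      (hw.norm.mul_const C) (fun n ↦ Eventually.of_forall fun x ↦ ?_)
      (Eventually.of_forall fun x ↦ (hlim x).const_mul _)
    rw [norm_mul]
    gcongr
    exact hf.norm_approxBounded_le hC0 n x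
  simp only [cintegral_withDensityᵥ_simpleFunc hw] at h1
  exact tendsto_nhds_unique h1 h2

theorem cintegral_map_withDensityᵥ {ν : Measure Y} {w : Y → ℂ} (hw : Integrable w ν)
    {q : Y → X} (hq : Measurable q) {f : X → ℂ} (hf : StronglyMeasurable f) {C : ℝ}
    (hC : ∀ x, ‖f x‖ ≤ C) :
    cintegral ((ν.withDensityᵥ w).map q) f = ∫ y, w y * f (q y) ∂ν := by
  have hfq : StronglyMeasurable (f ∘ q) := hf.comp_measurable hq
  have h := VectorMeasure.integral_map (μ := ν.withDensityᵥ w) (B := smulPairing ℂ) hq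
    (f := f) hf.aestronglyMeasurable
    (Integrable.of_bound hfq.aestronglyMeasurable C (Eventually.of_forall fun y ↦ hC (q y)))
  exact h.trans (cintegral_withDensityᵥ hw hfq fun y ↦ hC (q y))

/-- The polar decomposition of a complex measure: it has a density of modulus at most `1` with
respect to its total variation. -/
theorem exists_withDensityᵥ_variation_eq (μ : ComplexMeasure X) :
    ∃ h : X → ℂ, Measurable h ∧ (∀ x, ‖h x‖ ≤ 1) ∧ μ.variation.withDensityᵥ h = μ := by
  set ν := μ.variation with hν
  have hac : ∀ (s : SignedMeasure X), (∀ A, ‖s A‖ ≤ ‖μ A‖) → s.singularPart ν = 0 := by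
    intro s hs
    have h1 : s ≪ᵥ ν.toENNRealVectorMeasure := by
      refine VectorMeasure.AbsolutelyContinuous.mk fun A hA h0 ↦ ?_
      rw [Measure.toENNRealVectorMeasure_apply_measurable hA] at h0
      have h2 := VectorMeasure.enorm_measure_le_variation μ A
      rw [← hν, h0, nonpos_iff_eq_zero, enorm_eq_zero] at h2
      simpa [h2] using hs A
    have h2 := (SignedMeasure.absolutelyContinuous_iff_withDensityᵥ_rnDeriv_eq s ν).1 h1
    have h3 := s.singularPart_add_withDensity_rnDeriv_eq ν
    rw [h2] at h3
    simpa using h3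
  have hre : (ComplexMeasure.re μ).singularPart ν = 0 :=
    hac _ fun A ↦ Complex.abs_re_le_norm (μ A)
  have him : (ComplexMeasure.im μ).singularPart ν = 0 :=
    hac _ fun A ↦ Complex.abs_im_le_norm (μ A)
  have hsing : μ.singularPart ν = 0 := by
    unfold ComplexMeasure.singularPart
    rw [hre, him]
    ext A hA : 1
    simp [SignedMeasure.toComplexMeasure_apply]
    rfl
  have hdec : ν.withDensityᵥ (μ.rnDeriv ν) = μ := by
    have : μ.HaveLebesgueDecomposition ν := ⟨inferInstance, inferInstance⟩
    have h := ComplexMeasure.singularPart_add_withDensity_rnDeriv_eq (c := μ) (μ := ν)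
    rwa [hsing, zero_add] at h
  have hint := ComplexMeasure.integrable_rnDeriv μ ν
  have hvar : ν.withDensity (fun x ↦ ‖μ.rnDeriv ν x‖ₑ) = ν := by
    rw [← Measure.variation_withDensityᵥ hint, hdec]
  -- The density has modulus `1` almost everywhere, because `|μ|` has density `|h|` in `ν = |μ|`.
  have hae : (fun x ↦ ‖μ.rnDeriv ν x‖ₑ) =ᵐ[ν] fun _ ↦ 1 := by
    rw [← withDensity_eq_iff_of_sigmaFinite hint.aestronglyMeasurable.enorm aemeasurable_const,
      hvar]
    exact withDensity_one.symm
  have hmeas : Measurable (μ.rnDeriv ν) := by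
    refine measurable_of_re_im (𝕜 := ℂ) ?_ ?_
    · exact SignedMeasure.measurable_rnDeriv _ _
    · exact SignedMeasure.measurable_rnDeriv _ _
  refine ⟨{x | ‖μ.rnDeriv ν x‖ ≤ 1}.indicator (μ.rnDeriv ν),
    hmeas.indicator (measurableSet_le hmeas.norm measurable_const), fun x ↦ ?_, ?_⟩
  · by_cases hx : ‖μ.rnDeriv ν x‖ ≤ 1 <;> simp [Set.indicator, hx]
  · conv_rhs => rw [← hdec]
    refine WithDensityᵥEq.congr_ae ?_
    filter_upwards [hae] with x hx
    have : ‖μ.rnDeriv ν x‖ = 1 := by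
      simpa [enorm_eq_nnnorm, ← NNReal.coe_inj] using hx
    simp [Set.indicator, this]

end Density

/-! ### The one-point compactification -/

section OnePoint

variable {X : Type*} [TopologicalSpace X]

/-- The images of a countable basis and the complements of the sets of a compact exhaustion form a
basis of the one-point compactification. -/
instance secondCountableTopology_onePoint [T2Space X] [LocallyCompactSpace X]
    [SecondCountableTopology X] : SecondCountableTopology (OnePoint X) := by
  let K : CompactExhaustion X := default
  let B : Set (Set (OnePoint X)) :=
    (fun U : Set X ↦ ((↑) '' U : Set (OnePoint X))) '' countableBasis X ∪
      range fun n ↦ ((↑) '' K n : Set (OnePoint X))ᶜ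
  have hB : IsTopologicalBasis B := by
    refine isTopologicalBasis_of_isOpen_of_nhds ?_ ?_
    · rintro _ (⟨U, hU, rfl⟩ | ⟨n, rfl⟩)
      · exact OnePoint.isOpenEmbedding_coe.isOpenMap _ (isOpen_of_mem_countableBasis hU)
      · exact OnePoint.isOpen_compl_image_coe.2 ⟨(K.isCompact n).isClosed, K.isCompact n⟩
    · intro a V ha hV
      induction a using OnePoint.rec with
      | infty =>
        have hVc : IsCompact ((↑) ⁻¹' V : Set X)ᶜ :=
          ((OnePoint.isOpen_iff_of_mem ha).1 hV).2
        obtain ⟨n, hn⟩ := K.exists_superset_of_isCompact hVc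
        refine ⟨_, Or.inr ⟨n, rfl⟩, OnePoint.infty_notMem_image_coe, fun b hb ↦ ?_⟩
        induction b using OnePoint.rec with
        | infty => exact ha
        | coe x =>
          by_contra hx
          exact hb ⟨x, hn hx, rfl⟩
      | coe x =>
        obtain ⟨U, hU, hxU, hUV⟩ := (isBasis_countableBasis X).exists_subset_of_mem_open
          (show x ∈ (↑) ⁻¹' V from ha) (hV.preimage OnePoint.continuous_coe)
        exact ⟨_, Or.inl ⟨U, hU, rfl⟩, ⟨x, hxU, rfl⟩, by rintro _ ⟨y, hy, rfl⟩; exact hUV hy⟩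
  exact hB.secondCountableTopology
    (((countable_countableBasis X).image _).union (countable_range _))

/-- The extension by `0` at infinity of a function vanishing at infinity. -/
def extendZero [T2Space X] (f : C₀(X, ℂ)) : C(OnePoint X, ℂ) :=
  OnePoint.continuousMapMk f.toContinuousMap 0 (by
    rw [coclosedCompact_eq_cocompact]
    exact f.zero_at_infty')

@[simp]
theorem extendZero_coe [T2Space X] (f : C₀(X, ℂ)) (x : X) : extendZero f x = f x := rfl

@[simp]
theorem extendZero_infty [T2Space X] (f : C₀(X, ℂ)) : extendZero f OnePoint.infty = 0 := rfl

end OnePoint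

/-! ### The hyperspace as a continuous image of a compact metrizable space -/

section Hyperspace

variable {X : Type*} [TopologicalSpace X]

/-- The trace on `X` of a compact subset of the one-point compactification. -/
def traceClosed [T2Space X] [LocallyCompactSpace X] (K : Compacts (OnePoint X)) : ClosedSets X :=
  (⟨(↑) ⁻¹' (K : Set (OnePoint X)),
    K.isCompact.isClosed.preimage OnePoint.continuous_coe⟩ : Closeds X)

variable [T2Space X] [LocallyCompactSpace X]

theorem continuous_traceClosed : Continuous (traceClosed (X := X)) := by
  refine continuous_generateFrom_iff.2 ?_
  rintro _ (⟨C, hC, rfl⟩ | ⟨U, hU, rfl⟩)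
  · have h := Compacts.isOpen_subsets_of_isOpen
      (OnePoint.isOpen_compl_image_coe.2 ⟨hC.isClosed, hC⟩)
    convert! h using 1
    ext K
    constructor
    · rintro h _ hx ⟨x, hxC, rfl⟩
      exact (h.subset ⟨hx, hxC⟩ : x ∈ (∅ : Set X))
    · intro h
      exact eq_empty_of_forall_notMem fun x hx ↦ h hx.1 ⟨x, hx.2, rfl⟩
  · have h := Compacts.isOpen_inter_nonempty_of_isOpen
      (OnePoint.isOpenEmbedding_coe.isOpenMap _ hU)
    convert! h using 1
    ext K
    constructor
    · rintro ⟨x, hx, hxU⟩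
      exact ⟨x, hx, x, hxU, rfl⟩
    · rintro ⟨_, hx, x, hxU, rfl⟩
      exact ⟨x, hx, hxU⟩

/-- A closed set `E` is the trace of the compact set `E ∪ {∞}`. -/
theorem traceClosed_surjective : Function.Surjective (traceClosed (X := X)) := by
  intro E
  have hE : IsClosed (E.carrier) := Closeds.isClosed (E : Closeds X)
  have hopen : IsOpen ((↑) '' E.carrierᶜ : Set (OnePoint X)) :=
    OnePoint.isOpenEmbedding_coe.isOpenMap _ hE.isOpen_compl
  refine ⟨⟨((↑) '' E.carrierᶜ : Set (OnePoint X))ᶜ, hopen.isClosed_compl.isCompact⟩, ?_⟩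
  refine Closeds.ext (α := X) ?_
  change (↑) ⁻¹' ((↑) '' E.carrierᶜ : Set (OnePoint X))ᶜ = E.carrier
  rw [preimage_compl, preimage_image_eq _ OnePoint.coe_injective, compl_compl]

end Hyperspace

/-- By the portmanteau theorem, `ρ ↦ ρ U` is lower semicontinuous for `U` open. -/
theorem isClosed_setOf_measure_eq_zero {Ω : Type*} [TopologicalSpace Ω] [MeasurableSpace Ω]
    [HasOuterApproxClosed Ω] [OpensMeasurableSpace Ω] {U : Set Ω} (hU : IsOpen U) :
    IsClosed {ρ : ProbabilityMeasure Ω | (ρ : Measure Ω) U = 0} := by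
  rw [isClosed_iff_forall_filter]
  intro ρ F hF hmem hle
  have h := ProbabilityMeasure.le_liminf_measure_open_of_tendsto
    (μs := fun σ : ProbabilityMeasure Ω ↦ σ) (L := F) (μ := ρ) hle hU
  have h0 : (fun σ : ProbabilityMeasure Ω ↦ (σ : Measure Ω) U) =ᶠ[F] fun _ ↦ 0 :=
    hmem (mem_principal_self _)
  rw [liminf_congr h0, liminf_const] at h
  exact nonpos_iff_eq_zero.1 h

/-! ### The unit ball of `M(X)` as a continuous image of a compact metrizable space -/

section Parametrization

/-- The one-point compactification carries its Borel σ-algebra. -/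
instance measurableSpaceOnePoint (X : Type*) [TopologicalSpace X] : MeasurableSpace (OnePoint X) :=
  borel _

instance borelSpaceOnePoint (X : Type*) [TopologicalSpace X] : BorelSpace (OnePoint X) := ⟨rfl⟩

/-- The product of the one-point compactification of `X`, the space of positions, with the closed
unit disc, the space of phases. It is compact and metrizable. -/
abbrev PhaseSpace (X : Type*) : Type _ := OnePoint X × Metric.closedBall (0 : ℂ) 1

variable {X : Type*}

/-- The phase coordinate, replaced by `0` over the point at infinity. -/
def phase (p : PhaseSpace X) : ℂ :=
  {p : PhaseSpace X | p.1 = OnePoint.infty}ᶜ.indicator (fun p ↦ (p.2 : ℂ)) p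

/-- The position coordinate, with an arbitrary value over the point at infinity. -/
def position [Nonempty X] (p : PhaseSpace X) : X :=
  Function.extend ((↑) : X → OnePoint X) id (fun _ ↦ Classical.arbitrary X) p.1

@[simp]
theorem phase_coe (x : X) (z : Metric.closedBall (0 : ℂ) 1) :
    phase ((x : OnePoint X), z) = z := by
  simp [phase]

@[simp]
theorem phase_infty (z : Metric.closedBall (0 : ℂ) 1) :
    phase ((OnePoint.infty : OnePoint X), z) = 0 := by
  simp [phase]

@[simp]
theorem position_coe [Nonempty X] (x : X) (z : Metric.closedBall (0 : ℂ) 1) :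
    position ((x : OnePoint X), z) = x :=
  OnePoint.coe_injective.extend_apply _ _ _

theorem norm_phase_le (p : PhaseSpace X) : ‖phase p‖ ≤ 1 := by
  obtain ⟨x, z⟩ := p
  induction x using OnePoint.rec with
  | infty => simp
  | coe x => simpa using mem_closedBall_zero_iff.1 z.2

/-- The part of phase space that lies over a subset of `X`. -/
def phaseOver (U : Set X) : Set (PhaseSpace X) := Prod.fst ⁻¹' ((↑) '' U)

theorem isOpen_phaseOver [TopologicalSpace X] {U : Set X} (hU : IsOpen U) : IsOpen (phaseOver U) :=
  (OnePoint.isOpenEmbedding_coe.isOpenMap _ hU).preimage continuous_fst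

theorem measurable_position [TopologicalSpace X] [MeasurableSpace X] [BorelSpace X] [Nonempty X] :
    Measurable (position (X := X)) :=
  (OnePoint.isOpenEmbedding_coe.measurableEmbedding.measurable_extend measurable_id
    measurable_const).comp measurable_fst

variable [TopologicalSpace X] [T2Space X] [LocallyCompactSpace X] [SecondCountableTopology X]

theorem measurable_phase : Measurable (phase (X := X)) := by
  refine Measurable.indicator (measurable_subtype_coe.comp measurable_snd) ?_
  exact (measurable_fst (measurableSet_singleton OnePoint.infty)).compl

theorem integrable_phase (ρ : Measure (PhaseSpace X)) [IsFiniteMeasure ρ] :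
    Integrable phase ρ :=
  Integrable.of_bound measurable_phase.aestronglyMeasurable 1 (Eventually.of_forall norm_phase_le)

variable [MeasurableSpace X] [Nonempty X]

/-- The complex measure `A ↦ ∫ 1_A(x) z dρ(x, z)` on `X` with phases distributed according to
`ρ`. -/
def phaseMeasure (ρ : Measure (PhaseSpace X)) : ComplexMeasure X :=
  (ρ.withDensityᵥ phase).map position

/-- Equality can fail: mass at the same position with different phases may cancel. -/
theorem variation_phaseMeasure_le (ρ : Measure (PhaseSpace X)) [IsFiniteMeasure ρ] :
    (phaseMeasure ρ).variation ≤ (ρ.withDensity fun p ↦ ‖phase p‖ₑ).map position := by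
  refine VectorMeasure.variation_map_le.trans ?_
  rw [Measure.variation_withDensityᵥ (integrable_phase ρ)]

variable [BorelSpace X]

theorem phaseMeasure_apply (ρ : Measure (PhaseSpace X)) [IsFiniteMeasure ρ] {A : Set X}
    (hA : MeasurableSet A) :
    phaseMeasure ρ A = ∫ p in position ⁻¹' A, phase p ∂ρ := by
  rw [phaseMeasure, VectorMeasure.map_apply _ measurable_position hA,
    withDensityᵥ_apply (integrable_phase ρ) (measurable_position hA)]

theorem variation_phaseMeasure_univ_le (ρ : Measure (PhaseSpace X)) [IsProbabilityMeasure ρ] :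
    (phaseMeasure ρ).variation univ ≤ 1 := by
  refine (variation_phaseMeasure_le ρ univ).trans ?_
  rw [Measure.map_apply measurable_position MeasurableSet.univ, preimage_univ,
    withDensity_apply _ MeasurableSet.univ, Measure.restrict_univ]
  calc ∫⁻ p, ‖phase p‖ₑ ∂ρ ≤ ∫⁻ _, 1 ∂ρ := by
        refine lintegral_mono fun p ↦ ?_
        have := norm_phase_le p
        rwa [← toReal_enorm, ← ENNReal.toReal_one,
          ENNReal.toReal_le_toReal enorm_ne_top ENNReal.one_ne_top] at this
    _ = 1 := by simp

theorem variation_phaseMeasure_eq_zero {ρ : Measure (PhaseSpace X)} [IsFiniteMeasure ρ]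
    {U : Set X} (hU : IsOpen U) (h : ρ (phaseOver U) = 0) :
    (phaseMeasure ρ).variation U = 0 := by
  refine le_antisymm ((variation_phaseMeasure_le ρ U).trans ?_) bot_le
  rw [Measure.map_apply measurable_position hU.measurableSet,
    withDensity_apply _ (measurable_position hU.measurableSet), nonpos_iff_eq_zero,
    lintegral_eq_zero_iff measurable_phase.enorm, EventuallyEq,
    ae_restrict_iff' (measurable_position hU.measurableSet)]
  have h' : ∀ᵐ p ∂ρ, p ∉ phaseOver U := measure_eq_zero_iff_ae_notMem.1 h
  filter_upwards [h'] with p hp hpU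
  obtain ⟨x, z⟩ := p
  induction x using OnePoint.rec with
  | infty => simp
  | coe x =>
    refine absurd ⟨x, ?_, rfl⟩ hp
    simpa using hpU

/-- The map from probability measures on phase space to the unit ball of `M(X)`. -/
def phaseBall (ρ : ProbabilityMeasure (PhaseSpace X)) : MeasureBall X :=
  ⟨phaseMeasure (ρ : Measure (PhaseSpace X)), variation_phaseMeasure_univ_le _⟩

theorem continuous_phaseBall : Continuous (phaseBall (X := X)) := by
  refine continuous_induced_rng.2 (continuous_pi fun f ↦ ?_)
  -- The integrand `z f(x)` extends continuously by `0` to the point at infinity.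
  let g : BoundedContinuousFunction (PhaseSpace X) ℂ := BoundedContinuousFunction.mkOfCompact
    ⟨fun p ↦ (p.2 : ℂ) * extendZero f p.1, by fun_prop⟩
  have hg (ρ : ProbabilityMeasure (PhaseSpace X)) :
      cintegral (phaseBall ρ).1 f = ∫ p, g p ∂(ρ : Measure (PhaseSpace X)) := by
    have h := cintegral_map_withDensityᵥ (integrable_phase (ρ : Measure (PhaseSpace X)))
      measurable_position (f := f) (map_continuous f).stronglyMeasurable
      (C := ‖f.toBCF‖) f.toBCF.norm_coe_le_norm
    refine h.trans (integral_congr_ae (Eventually.of_forall fun p ↦ ?_))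
    obtain ⟨x, z⟩ := p
    induction x using OnePoint.rec with
    | infty => simp [g]
    | coe x => simp [g]
  simp only [Function.comp_def, hg]
  rw [continuous_iff_continuousAt]
  intro ρ
  exact (ProbabilityMeasure.tendsto_iff_forall_integral_rclike_tendsto ℂ).1 tendsto_id g

/-- Every measure in the unit ball of `M(X)` comes from a probability measure on phase space whose
marginal is the total variation, the missing mass being put at infinity. -/
theorem exists_phaseBall_eq (μ : MeasureBall X) :
    ∃ ρ : ProbabilityMeasure (PhaseSpace X), phaseBall ρ = μ ∧
      ∀ U : Set X, IsOpen U → μ.1.variation U = 0 →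
        (ρ : Measure (PhaseSpace X)) (phaseOver U) = 0 := by
  obtain ⟨μ, hμ⟩ := μ
  obtain ⟨h, hmeas, hle, hμh⟩ := exists_withDensityᵥ_variation_eq μ
  let g : X → PhaseSpace X := fun x ↦ ((x : OnePoint X), ⟨h x, by simpa using hle x⟩)
  have hg : Measurable g :=
    OnePoint.continuous_coe.measurable.prodMk (hmeas.subtype_mk)
  let p₀ : PhaseSpace X := (OnePoint.infty, ⟨0, by simp⟩)
  let ρ : Measure (PhaseSpace X) :=
    μ.variation.map g + (1 - μ.variation univ) • Measure.dirac p₀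
  have hρ : IsProbabilityMeasure ρ := by
    constructor
    simp only [ρ, Measure.add_apply, Measure.map_apply hg MeasurableSet.univ, preimage_univ,
      Measure.smul_apply, measure_univ, smul_eq_mul, mul_one]
    exact add_tsub_cancel_of_le hμ
  refine ⟨⟨ρ, hρ⟩, Subtype.ext ?_, fun U hU h0 ↦ ?_⟩
  · change phaseMeasure ρ = μ
    ext A hA : 1
    have hA' : MeasurableSet (position (X := X) ⁻¹' A) := measurable_position hA
    have hint := integrable_phase ρ
    rw [phaseMeasure_apply ρ hA, ← integral_indicator hA']
    have hint' := hint.indicator hA'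
    rw [integral_add_measure hint'.left_of_add_measure hint'.right_of_add_measure,
      integral_smul_measure, integral_dirac, integral_map hg.aemeasurable
        (measurable_phase.indicator hA').aestronglyMeasurable]
    have h0 : (position (X := X) ⁻¹' A).indicator phase p₀ = 0 := by
      simp [p₀, Set.indicator]
    rw [h0, smul_zero, add_zero]
    conv_rhs => rw [← hμh, withDensityᵥ_apply (Integrable.of_bound hmeas.aestronglyMeasurable 1
      (Eventually.of_forall hle)) hA, ← integral_indicator hA]
    refine integral_congr_ae (Eventually.of_forall fun x ↦ ?_)
    have hx : g x ∈ position (X := X) ⁻¹' A ↔ x ∈ A := by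
      rw [mem_preimage, position_coe]
    change (position ⁻¹' A).indicator phase (g x) = A.indicator h x
    by_cases hxA : x ∈ A
    · rw [indicator_of_mem (hx.2 hxA), indicator_of_mem hxA, phase_coe]
    · rw [indicator_of_notMem (mt hx.1 hxA), indicator_of_notMem hxA]
  · have hUm : MeasurableSet (phaseOver U) := (isOpen_phaseOver hU).measurableSet
    have h1 : g ⁻¹' phaseOver U = U := by
      ext x
      simp [g, phaseOver]
    have h2 : p₀ ∉ phaseOver U := by simp [p₀, phaseOver]
    simp [ρ, Measure.map_apply hg hUm, h1, h0, Measure.dirac_apply' _ hUm, h2]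

end Parametrization

/-! ### Coefficients of the regular representation -/

section Coefficients

/-- Continuous complex-linear maps commute with integration against a complex measure. -/
theorem continuousLinearMap_cintegral {X V W : Type*} [MeasurableSpace X] [NormedAddCommGroup V]
    [NormedSpace ℂ V] [CompleteSpace V] [NormedAddCommGroup W] [NormedSpace ℂ W] [CompleteSpace W]
    {μ : ComplexMeasure X} {f : X → V} (hf : μ.Integrable f) (L : V →L[ℂ] W) :
    L (cintegral μ f) = cintegral μ fun x ↦ L (f x) := by
  let C : V →L[ℝ] W := L.restrictScalars ℝ
  have h1 := VectorMeasure.integral_continuousLinearMap_comp (B := smulPairing W) (C := C) hf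
  have h2 := VectorMeasure.continuousLinearMap_apply_integral (B := smulPairing V) (C := C) hf
  have h3 : smulPairing W ∘L C = (ContinuousLinearMap.compL ℝ ℂ V W C) ∘L smulPairing V := by
    refine ContinuousLinearMap.ext fun v ↦ ContinuousLinearMap.ext fun z ↦ ?_
    change z • L v = L (z • v)
    exact (L.map_smul z v).symm
  rw [h3, ← h2] at h1
  exact h1.symm

theorem exists_ae_compactSupport_norm_sub_le {X : Type*} [TopologicalSpace X] [NormalSpace X]
    [R1Space X] [WeaklyLocallyCompactSpace X] [MeasurableSpace X] [BorelSpace X] {m : Measure X} [m.Regular]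
    (ξ : Lp ℂ 2 m) {ε : ℝ} (hε : 0 < ε) :
    ∃ (f : Lp ℂ 2 m) (K : Set X), IsCompact K ∧ (∀ᵐ x ∂m, x ∉ K → f x = 0) ∧ ‖ξ - f‖ ≤ ε := by
  obtain ⟨f, hfc, hle, -, hf⟩ := (Lp.memLp ξ).exists_hasCompactSupport_eLpNorm_sub_le
    (by simp) (ε := ENNReal.ofReal ε) (by simpa using hε)
  refine ⟨hf.toLp f, tsupport f, hfc, ?_, ?_⟩
  · filter_upwards [hf.coeFn_toLp] with x hx hxK
    rw [hx, image_eq_zero_of_notMem_tsupport hxK]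
  · rw [Lp.norm_def]
    refine ENNReal.toReal_le_of_le_ofReal hε.le ?_
    refine (eLpNorm_congr_ae ?_).trans_le hle
    filter_upwards [Lp.coeFn_sub ξ (hf.toLp f), hf.coeFn_toLp] with x h1 h2
    exact h1.trans (congrArg (ξ x - ·) h2)

variable {G : Type*} [Group G] [TopologicalSpace G] [IsTopologicalGroup G] [MeasurableSpace G]
  [BorelSpace G] (m : Measure G) [m.IsHaarMeasure]

theorem inner_leftReg_eq_zero {f g : Lp ℂ 2 m} {K L : Set G} (hf : ∀ᵐ x ∂m, x ∉ K → f x = 0)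
    (hg : ∀ᵐ x ∂m, x ∉ L → g x = 0) {s : G} (hs : s ∉ L * K⁻¹) :
    inner ℂ g (leftReg m s f) = 0 := by
  rw [L2.inner_def]
  refine integral_eq_zero_of_ae ?_
  have hmp : MeasurePreserving (fun x ↦ s⁻¹ * x) m m := measurePreserving_mul_left m s⁻¹
  filter_upwards [hg, hmp.quasiMeasurePreserving.ae hf,
    Lp.coeFn_compMeasurePreserving f hmp] with x hx1 hx2 hx3
  change inner ℂ (g x) ((leftReg m s f : Lp ℂ 2 m) x) = 0
  have hx4 : (leftReg m s f : Lp ℂ 2 m) x = f (s⁻¹ * x) := hx3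
  rw [hx4]
  by_cases hxL : x ∈ L
  · rw [hx2, inner_zero_right]
    intro hxK
    exact hs ⟨x, hxL, x⁻¹ * s, by simpa using hxK, by simp⟩
  · rw [hx1 hxL, inner_zero_left]

variable [T2Space G] [LocallyCompactSpace G] [SecondCountableTopology G]

/-- Approximating `ξ` and `η` by functions that vanish off compact sets `K` and `L` changes the
coefficient uniformly little, and the new coefficient vanishes off `L K⁻¹`. -/
theorem tendsto_inner_leftReg (ξ η : Lp ℂ 2 m) :
    Tendsto (fun s ↦ inner ℂ η (leftReg m s ξ)) (cocompact G) (𝓝 0) := by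
  rw [Metric.tendsto_nhds]
  intro ε hε
  set M := ‖ξ‖ + ‖η‖ + 1 with hM
  have hMpos : 0 < M := by positivity
  set δ := min 1 (ε / (2 * M)) with hδ
  have hδpos : 0 < δ := lt_min one_pos (by positivity)
  obtain ⟨f, K, hK, hf, hξf⟩ := exists_ae_compactSupport_norm_sub_le ξ hδpos
  obtain ⟨g, L, hL, hg, hηg⟩ := exists_ae_compactSupport_norm_sub_le η hδpos
  filter_upwards [(hL.mul hK.inv).compl_mem_cocompact] with s hs
  have h0 := inner_leftReg_eq_zero m hf hg hs
  have hsplit : inner ℂ η (leftReg m s ξ) =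
      inner ℂ (η - g) (leftReg m s ξ) + inner ℂ g (leftReg m s (ξ - f)) := by
    rw [map_sub, inner_sub_left, inner_sub_right, h0]
    ring
  rw [dist_zero_right, hsplit]
  have hgle : ‖g‖ ≤ ‖η‖ + 1 := by
    have h1 : ‖g‖ ≤ ‖η‖ + ‖η - g‖ := by
      simpa using norm_sub_le η (η - g)
    exact h1.trans (by gcongr; exact hηg.trans (min_le_left _ _))
  calc _ ≤ ‖inner ℂ (η - g) (leftReg m s ξ)‖ + ‖inner ℂ g (leftReg m s (ξ - f))‖ :=
        norm_add_le _ _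
    _ ≤ ‖η - g‖ * ‖leftReg m s ξ‖ + ‖g‖ * ‖leftReg m s (ξ - f)‖ :=
        add_le_add (norm_inner_le_norm _ _) (norm_inner_le_norm _ _)
    _ = ‖η - g‖ * ‖ξ‖ + ‖g‖ * ‖ξ - f‖ := by
        rw [LinearIsometry.norm_map, LinearIsometry.norm_map]
    _ ≤ δ * ‖ξ‖ + (‖η‖ + 1) * δ := by gcongr
    _ = δ * M := by rw [hM]; ring
    _ ≤ ε / (2 * M) * M := by gcongr; exact min_le_right _ _
    _ = ε / 2 := by field_simp
    _ < ε := half_lt_self hε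

/-- The coefficient `s ↦ ⟨η, λ_s ξ⟩` of the regular representation, which vanishes at infinity. -/
def coefficient (ξ η : Lp ℂ 2 m) : C₀(G, ℂ) where
  toFun s := inner ℂ η (leftReg m s ξ)
  continuous_toFun := continuous_const.inner (continuous_leftReg m ξ)
  zero_at_infty' := tendsto_inner_leftReg m ξ η

theorem inner_convOp (μ : ComplexMeasure G) (ξ η : Lp ℂ 2 m) :
    inner ℂ η (convOp m μ ξ) = cintegral μ (coefficient m ξ η) :=
  continuousLinearMap_cintegral (integrable_leftReg m μ ξ) (innerSL ℂ η)

theorem continuous_inner_convOp (ξ η : Lp ℂ 2 m) :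
    Continuous fun μ : MeasureBall G ↦ inner ℂ η (convOp m μ.1 ξ) := by
  simp only [inner_convOp]
  have h : Continuous fun (μ : MeasureBall G) (f : C₀(G, ℂ)) ↦ cintegral μ.1 f :=
    continuous_induced_dom
  exact continuous_pi_iff.1 h _

/-- The operator norm is lower semicontinuous for the weak operator topology, for which
`μ ↦ λ(μ)` is continuous. -/
theorem isClosed_setOf_norm_convOp_sub_le (A : Lp ℂ 2 m →L[ℂ] Lp ℂ 2 m) {r : ℝ} (hr : 0 ≤ r) :
    IsClosed {μ : MeasureBall G | ‖convOp m μ.1 - A‖ ≤ r} := by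
  have h : {μ : MeasureBall G | ‖convOp m μ.1 - A‖ ≤ r} =
      ⋂ (ξ : Lp ℂ 2 m) (η : Lp ℂ 2 m),
        {μ | ‖inner ℂ η (convOp m μ.1 ξ) - inner ℂ η (A ξ)‖ ≤ r * ‖ξ‖ * ‖η‖} := by
    ext μ
    simp only [mem_iInter, mem_ofPred_eq, ← inner_sub_right, ← sub_apply]
    constructor
    · intro hle ξ η
      calc _ ≤ ‖η‖ * ‖(convOp m μ.1 - A) ξ‖ := norm_inner_le_norm _ _
        _ ≤ ‖η‖ * (r * ‖ξ‖) := by gcongr; exact ContinuousLinearMap.le_of_opNorm_le _ hle ξ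
        _ = r * ‖ξ‖ * ‖η‖ := by ring
    · intro hle
      refine ContinuousLinearMap.opNorm_le_bound _ hr fun ξ ↦ ?_
      have h1 := hle ξ ((convOp m μ.1 - A) ξ)
      rw [inner_self_eq_norm_sq_to_K] at h1
      rcases (norm_nonneg ((convOp m μ.1 - A) ξ)).eq_or_lt with h2 | h2
      · rw [← h2]; positivity
      · refine le_of_mul_le_mul_right ?_ h2
        calc _ = ‖((‖(convOp m μ.1 - A) ξ‖ : ℂ)) ^ 2‖ := by
              rw [norm_pow, Complex.norm_real, norm_norm, sq]
          _ ≤ _ := h1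
  rw [h]
  refine isClosed_iInter fun ξ ↦ isClosed_iInter fun η ↦ isClosed_le ?_ continuous_const
  exact ((continuous_inner_convOp m ξ η).sub continuous_const).norm

end Coefficients

/-! ### The reduced C*-algebra -/

section ReducedCstar

variable {G : Type*} [Group G] [TopologicalSpace G] [IsTopologicalGroup G] [T2Space G]
  [LocallyCompactSpace G] [SecondCountableTopology G] [MeasurableSpace G] [BorelSpace G]
  (m : Measure G) [m.IsHaarMeasure]

theorem norm_convOp_le (μ : ComplexMeasure G) : ‖convOp m μ‖ ≤ μ.variation.real univ :=
  LinearMap.mkContinuous_norm_le _ measureReal_nonneg _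

theorem convOp_sub (μ ν : ComplexMeasure G) : convOp m (μ - ν) = convOp m μ - convOp m ν := by
  ext1 ξ
  exact VectorMeasure.integral_sub_vectorMeasure (B := smulPairing _)
    (integrable_leftReg m μ ξ) (integrable_leftReg m ν ξ)

theorem convOp_smul (c : ℝ) (μ : ComplexMeasure G) : convOp m (c • μ) = c • convOp m μ := by
  ext1 ξ
  exact VectorMeasure.integral_smul_vectorMeasure (B := smulPairing _) _ c

theorem convOp_zero : convOp m (0 : ComplexMeasure G) = 0 := by
  have h := convOp_sub m 0 0
  rwa [sub_zero, sub_self] at h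

theorem continuous_convOp_withDensityᵥ :
    Continuous fun f : Lp ℂ 1 m ↦ convOp m (m.withDensityᵥ f) := by
  refine (LipschitzWith.of_dist_le_mul (K := 1) fun f g ↦ ?_).continuous
  have hf := L1.integrable_coeFn f
  have hg := L1.integrable_coeFn g
  rw [dist_eq_norm, ← convOp_sub, ← withDensityᵥ_sub hf hg, NNReal.coe_one, one_mul, dist_eq_norm]
  refine (norm_convOp_le m _).trans_eq ?_
  rw [measureReal_def, Measure.variation_withDensityᵥ (hf.sub hg),
    withDensity_apply _ MeasurableSet.univ, Measure.restrict_univ, Lp.norm_def,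
    eLpNorm_one_eq_lintegral_enorm]
  congr 1
  refine lintegral_congr_ae ?_
  filter_upwards [Lp.coeFn_sub f g] with x hx
  rw [hx]

theorem smul_mem_reducedCstar (c : ℝ) {T : Lp ℂ 2 m →L[ℂ] Lp ℂ 2 m} (hT : T ∈ reducedCstar m) :
    c • T ∈ reducedCstar m := by
  refine map_mem_closure (continuous_const_smul c) hT ?_
  rintro _ ⟨f, rfl⟩
  refine ⟨c • f, ?_⟩
  change convOp m (m.withDensityᵥ (c • f : Lp ℂ 1 m)) = c • convOp m (m.withDensityᵥ f)
  rw [← convOp_smul, ← withDensityᵥ_smul]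
  congr 1
  exact WithDensityᵥEq.congr_ae (Lp.coeFn_smul c f)

theorem zero_mem_reducedCstar : (0 : Lp ℂ 2 m →L[ℂ] Lp ℂ 2 m) ∈ reducedCstar m := by
  have h : convOp m (m.withDensityᵥ (0 : Lp ℂ 1 m)) ∈ reducedCstar m :=
    subset_closure (mem_range_self _)
  simpa using smul_mem_reducedCstar m 0 h

/-- The reduced C*-algebra is norm separable, because `L¹(G)` is. -/
theorem exists_dense_seq_reducedCstar :
    ∃ A : ℕ → Lp ℂ 2 m →L[ℂ] Lp ℂ 2 m, reducedCstar m = closure (range A) := by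
  have : Fact ((1 : ℝ≥0∞) ≠ ∞) := ⟨by simp⟩
  have : SeparableSpace (Lp ℂ 1 m) := inferInstance
  refine ⟨fun n ↦ convOp m (m.withDensityᵥ (denseSeq (Lp ℂ 1 m) n)), ?_⟩
  refine Subset.antisymm (closure_minimal ?_ isClosed_closure) (closure_mono ?_)
  · have h := (continuous_convOp_withDensityᵥ m).range_subset_closure_image_dense
      (denseRange_denseSeq (Lp ℂ 1 m))
    rwa [← range_comp] at h
  · rintro _ ⟨n, rfl⟩
    exact mem_range_self _

/-- Membership of `λ(μ)` in the reduced C*-algebra as a countable condition on the distances of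
`λ(μ)` to a dense sequence, each of which defines a weak-star closed set. -/
theorem setOf_convOp_mem_reducedCstar_eq :
    ∃ A : ℕ → Lp ℂ 2 m →L[ℂ] Lp ℂ 2 m, {μ : MeasureBall G | convOp m μ.1 ∈ reducedCstar m} =
      ⋂ k : ℕ, ⋃ n : ℕ, {μ | ‖convOp m μ.1 - A n‖ ≤ 1 / ((k : ℝ) + 1)} := by
  obtain ⟨A, hA⟩ := exists_dense_seq_reducedCstar m
  refine ⟨A, ?_⟩
  ext μ
  simp only [hA, mem_ofPred_eq, mem_iInter, mem_iUnion, Metric.mem_closure_range_iff, dist_eq_norm]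
  constructor
  · intro h k
    obtain ⟨n, hn⟩ := h _ (Nat.one_div_pos_of_nat (n := k))
    exact ⟨n, hn.le⟩
  · intro h ε hε
    obtain ⟨k, hk⟩ := exists_nat_one_div_lt hε
    obtain ⟨n, hn⟩ := h k
    exact ⟨n, hn.trans_lt hk⟩

end ReducedCstar

/-! ### Analyticity of the multiplicity pairs -/

section Main

theorem mem_measuresOn_iff {X : Type*} [TopologicalSpace X] [HereditarilyLindelofSpace X]
    [MeasurableSpace X] {E : Set X} (hE : IsClosed E) {μ : ComplexMeasure X} :
    μ ∈ measuresOn E ↔ μ.variation Eᶜ = 0 :=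
  ⟨fun h ↦ measure_mono_null (compl_subset_compl.2 h) Measure.measure_compl_support,
    fun h ↦ Measure.support_subset_of_isClosed hE h⟩

theorem polishSpace_of_compactSpace (X : Type*) [TopologicalSpace X] [CompactSpace X]
    [MetrizableSpace X] : PolishSpace X := by
  let _ : MetricSpace X := metrizableSpaceMetric X
  infer_instance

/-- The Polish space that parametrizes the pairs of a measure and a closed set. -/
abbrev ParameterSpace (X : Type*) [TopologicalSpace X] : Type _ :=
  ProbabilityMeasure (PhaseSpace X) × Compacts (OnePoint X)

/-- The parameters `(ρ, K)` for which `ρ` is concentrated over the closed set given by `K` and the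
point at infinity. -/
def concentrated (X : Type*) [TopologicalSpace X] [T2Space X] [LocallyCompactSpace X] :
    Set (ParameterSpace X) :=
  {p | (p.1 : Measure (PhaseSpace X)) (phaseOver (traceClosed p.2).carrierᶜ) = 0}

/-- Only countably many open sets, each missing the closed set or null for `ρ`, need to be
tested. -/
theorem concentrated_eq (X : Type*) [TopologicalSpace X] [T2Space X] [LocallyCompactSpace X]
    [SecondCountableTopology X] :
    concentrated X = ⋂ U ∈ countableBasis X,
      ({p | ((p.2 : Set (OnePoint X)) ∩ (↑) '' U).Nonempty} ∪
        {p | (p.1 : Measure (PhaseSpace X)) (phaseOver U) = 0}) := by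
  ext ⟨ρ, K⟩
  simp only [concentrated, mem_ofPred_eq, mem_iInter, mem_union]
  constructor
  · intro h U hU
    by_cases hne : ((K : Set (OnePoint X)) ∩ (↑) '' U).Nonempty
    · exact Or.inl hne
    · refine Or.inr (measure_mono_null (preimage_mono (image_mono ?_)) h)
      exact fun x hxU hxK ↦ hne ⟨x, hxK, x, hxU, rfl⟩
  · intro h
    have hopen : IsOpen (traceClosed K).carrierᶜ :=
      (Closeds.isClosed (traceClosed K : Closeds X)).isOpen_compl
    have hsub : phaseOver (traceClosed K).carrierᶜ ⊆
        ⋃ U ∈ {U ∈ countableBasis X | U ⊆ (traceClosed K).carrierᶜ}, phaseOver U := by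
      rintro ⟨_, z⟩ ⟨x, hx, rfl⟩
      obtain ⟨U, hU, hxU, hUK⟩ := (isBasis_countableBasis X).exists_subset_of_mem_open hx hopen
      exact mem_biUnion ⟨hU, hUK⟩ ⟨x, hxU, rfl⟩
    refine measure_mono_null hsub ((measure_biUnion_null_iff
      ((countable_countableBasis X).mono fun U hU ↦ hU.1)).2 fun U hU ↦ ?_)
    refine (h U hU.1).resolve_left ?_
    rintro ⟨_, hxK, x, hxU, rfl⟩
    exact hU.2 hxU hxK

theorem measurableSet_concentrated (X : Type*) [TopologicalSpace X] [T2Space X]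
    [LocallyCompactSpace X] [SecondCountableTopology X] :
    MeasurableSet[borel (ParameterSpace X)] (concentrated X) := by
  let _ : MeasurableSpace (ParameterSpace X) := borel _
  have : BorelSpace (ParameterSpace X) := ⟨rfl⟩
  rw [concentrated_eq]
  refine MeasurableSet.biInter (countable_countableBasis X) fun U hU ↦ ?_
  have hUo := isOpen_of_mem_countableBasis hU
  refine MeasurableSet.union (IsOpen.measurableSet ?_) (IsClosed.measurableSet ?_)
  · exact (Compacts.isOpen_inter_nonempty_of_isOpen
      (OnePoint.isOpenEmbedding_coe.isOpenMap _ hUo)).preimage continuous_snd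
  · exact (isClosed_setOf_measure_eq_zero (isOpen_phaseOver hUo)).preimage continuous_fst

/-- The map from the parameter space onto the pairs of a measure and a closed set. -/
def parametrization {X : Type*} [TopologicalSpace X] [T2Space X] [LocallyCompactSpace X]
    [SecondCountableTopology X] [MeasurableSpace X] [BorelSpace X] [Nonempty X]
    (p : ParameterSpace X) : MeasureBall X × ClosedSets X :=
  (phaseBall p.1, traceClosed p.2)

theorem continuous_parametrization {X : Type*} [TopologicalSpace X] [T2Space X]
    [LocallyCompactSpace X] [SecondCountableTopology X] [MeasurableSpace X] [BorelSpace X]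
    [Nonempty X] : Continuous (parametrization (X := X)) :=
  (continuous_phaseBall.comp continuous_fst).prodMk (continuous_traceClosed.comp continuous_snd)

variable {G : Type*} [Group G] [TopologicalSpace G] [IsTopologicalGroup G] [T2Space G]
  [LocallyCompactSpace G] [SecondCountableTopology G] [MeasurableSpace G] [BorelSpace G]
  (m : Measure G) [m.IsHaarMeasure]

/-- Concentration of `ρ` over the closed set is sufficient for the support condition on the measure
given by `ρ`; it is not necessary for each `ρ`, but it holds for the one of
`exists_phaseBall_eq`. -/
theorem multiplicityPairs_eq_image :
    multiplicityPairs m = parametrization '' (concentrated G ∩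
      {p | convOp m (phaseBall p.1).1 ∈ reducedCstar m ∧ convOp m (phaseBall p.1).1 ≠ 0}) := by
  have hclosed (E : ClosedSets G) : IsClosed E.carrier := Closeds.isClosed (E : Closeds G)
  ext ⟨μ, E⟩
  constructor
  · rintro ⟨hE, hμ⟩
    obtain ⟨ρ, rfl, hρ⟩ := exists_phaseBall_eq μ
    obtain ⟨K, rfl⟩ := traceClosed_surjective E
    refine ⟨(ρ, K), ⟨hρ _ (hclosed _).isOpen_compl ?_, hμ⟩, rfl⟩
    exact (mem_measuresOn_iff (hclosed _)).1 hE
  · rintro ⟨⟨ρ, K⟩, ⟨hρ, hμ⟩, h⟩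
    obtain ⟨rfl, rfl⟩ := Prod.ext_iff.1 h
    refine ⟨(mem_measuresOn_iff (hclosed _)).2 ?_, hμ⟩
    exact variation_phaseMeasure_eq_zero (hclosed _).isOpen_compl hρ

theorem measurableSet_setOf_convOp_phaseBall :
    MeasurableSet[borel (ParameterSpace G)]
      {p | convOp m (phaseBall p.1).1 ∈ reducedCstar m ∧ convOp m (phaseBall p.1).1 ≠ 0} := by
  let _ : MeasurableSpace (ParameterSpace G) := borel _
  have : BorelSpace (ParameterSpace G) := ⟨rfl⟩
  have hcont : Continuous fun p : ParameterSpace G ↦ phaseBall p.1 :=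
    continuous_phaseBall.comp continuous_fst
  refine MeasurableSet.inter (s₁ := (fun p : ParameterSpace G ↦ phaseBall p.1) ⁻¹'
    {μ | convOp m μ.1 ∈ reducedCstar m}) (s₂ := {p | convOp m (phaseBall p.1).1 ≠ 0}) ?_ ?_
  · obtain ⟨A, hA⟩ := setOf_convOp_mem_reducedCstar_eq m
    rw [hA]
    simp only [preimage_iInter, preimage_iUnion]
    refine MeasurableSet.iInter fun k ↦ MeasurableSet.iUnion fun n ↦ IsClosed.measurableSet ?_
    exact (isClosed_setOf_norm_convOp_sub_le m (A n) (by positivity)).preimage hcont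
  · refine IsOpen.measurableSet ?_
    have h := ((isClosed_setOf_norm_convOp_sub_le m 0 le_rfl).preimage hcont).isOpen_compl
    convert! h using 1
    ext p
    simp

theorem analyticSet_multiplicityPairs : AnalyticSet (multiplicityPairs m) := by
  let _ : MeasurableSpace (ParameterSpace G) := borel _
  have : BorelSpace (ParameterSpace G) := ⟨rfl⟩
  have h1 : PolishSpace (ProbabilityMeasure (PhaseSpace G)) := polishSpace_of_compactSpace _
  have h2 : PolishSpace (Compacts (OnePoint G)) := polishSpace_of_compactSpace _
  rw [multiplicityPairs_eq_image]
  exact (((measurableSet_concentrated G).inter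
    (measurableSet_setOf_convOp_phaseBall m)).analyticSet).image_of_continuous
      continuous_parametrization

theorem restrictedMultiplicity_eq_image :
    restrictedMultiplicity m = Prod.snd '' multiplicityPairs m := by
  ext E
  constructor
  · intro hE
    have h0 : (0 : Lp ℂ 2 m →L[ℂ] Lp ℂ 2 m) ∈
        convOp m '' measuresOn E.carrier ∩ reducedCstar m := by
      refine ⟨⟨0, ?_, convOp_zero m⟩, zero_mem_reducedCstar m⟩
      simp [measuresOn]
    have hne : ∃ T ∈ convOp m '' measuresOn E.carrier ∩ reducedCstar m, T ≠ 0 := by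
      by_contra! h
      exact hE (Subset.antisymm h (singleton_subset_iff.2 h0))
    obtain ⟨_, ⟨⟨μ, hμE, rfl⟩, hμC⟩, hμ0⟩ := hne
    -- Scaling by `c` brings the total variation below `1`.
    set c : ℝ := (μ.variation.real univ + 1)⁻¹ with hc
    have hc0 : 0 < c := by positivity
    have hvar : (c • μ).variation = ‖c‖₊ • μ.variation := VectorMeasure.variation_smul
    refine ⟨(⟨c • μ, ?_⟩, E), ⟨?_, ?_, ?_⟩, rfl⟩
    · rw [hvar, ← ENNReal.toReal_le_toReal (measure_ne_top _ _) ENNReal.one_ne_top]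
      change (‖c‖₊ • μ.variation).real univ ≤ 1
      rw [measureReal_nnreal_smul_apply, coe_nnnorm, Real.norm_of_nonneg hc0.le, hc,
        inv_mul_le_one₀ (by positivity)]
      linarith
    · change (c • μ).variation.support ⊆ E.carrier
      rw [hvar]
      exact (Measure.AbsolutelyContinuous.support_mono
        (Measure.smul_absolutelyContinuous)).trans hμE
    · change convOp m (c • μ) ∈ reducedCstar m
      rw [convOp_smul]
      exact smul_mem_reducedCstar m c hμC
    · change convOp m (c • μ) ≠ 0
      rw [convOp_smul]
      exact smul_ne_zero hc0.ne' hμ0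
  · rintro ⟨⟨μ, E⟩, ⟨hE, hC, h0⟩, rfl⟩ h
    have hmem : convOp m μ.1 ∈ convOp m '' measuresOn E.carrier ∩ reducedCstar m :=
      ⟨⟨_, hE, rfl⟩, hC⟩
    exact h0 (h.subset hmem)

end Main

end Uniqueness

end

theorem theorem4p9 {G : Type*} [Group G] [TopologicalSpace G] [IsTopologicalGroup G] [T2Space G]
    [LocallyCompactSpace G] [SecondCountableTopology G] [MeasurableSpace G] [BorelSpace G]
    (m : Measure G) [m.IsHaarMeasure] :
    Uniqueness.IsCoanalytic (Uniqueness.extendedUniqueness m) ∧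
    AnalyticSet (Uniqueness.multiplicityPairs m) ∧
    Uniqueness.restrictedMultiplicity m = Prod.snd '' Uniqueness.multiplicityPairs m := by
  refine ⟨?_, Uniqueness.analyticSet_multiplicityPairs m,
    Uniqueness.restrictedMultiplicity_eq_image m⟩
  have h := (Uniqueness.analyticSet_multiplicityPairs m).image_of_continuous continuous_snd
  rwa [← Uniqueness.restrictedMultiplicity_eq_image] at h
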